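/- Let $n\ge 2$, let $\mathbb{T}\subset\mathbb{C}$ be the unit circle, $\mathbb{D}$ the open unit disc, and let $m_n$ be the normalized Lebesgue measure on $\mathbb{T}^n$. For $z\in\mathbb{D}^n$ and $\zeta\in\mathbb{T}^n$ let $$P(z,\zeta)=\prod_{j=1}^n\frac{1-|z_j|^2}{|1-z_j\overline{\zeta_j}|^2}$$ be the Poisson kernel. Let $\mu$ be a complex Borel measure on $\mathbb{T}^n$ that is pluriharmonic, that is, its Poisson integral $P[\mu](z)=\int_{\mathbb{T}^n}P(z,\zeta)\,d\mu(\zeta)$ is a pluriharmonic function on $\mathbb{D}^n$ (of class $C^2$ and harmonic on every complex line). Then: 1. For $m_n$-almost every $\zeta\in\mathbb{T}^n$ there is a unique complex Borel measure $\mu_\zeta$ on $\mathbb{T}^n$, the slice measure of $\mu$ at $\zeta$, that is supported on the circle $\mathbb{T}\zeta=\{\eta\zeta:\eta\in\mathbb{T}\}$ and satisfies $$P[\mu](\lambda\zeta)=\int_{\mathbb{T}\zeta}\frac{1-|\lambda|^2}{\|w-\lambda\zeta\|_\infty^2}\,d\mu_\zeta(w)\quad\text{for all }\lambda\in\mathbb{D},$$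 where $\|\cdot\|_\infty$ is the maximum norm on $\mathbb{C}^n$, so that $\|w-\lambda\zeta\|_\infty=|\eta-\lambda|$ for $w=\eta\zeta$, $\eta\in\mathbb{T}$. 2. $\mu=\int_{\mathbb{T}^n}\mu_\zeta\,dm_n(\zeta)$ in the weak sense: for every $f\in C(\mathbb{T}^n)$ the function $\zeta\mapsto\int_{\mathbb{T}^n} f\,d\mu_\zeta$ (defined $m_n$-a.e.) is $m_n$-integrable, and $$\int_{\mathbb{T}^n} f\,d\mu=\int_{\mathbb{T}^n}\int_{\mathbb{T}^n} f\,d\mu_\zeta\,dm_n(\zeta).$$ -/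

import Mathlib

open MeasureTheory
open scoped ComplexConjugate

noncomputable section

namespace TorusSlices

/-- The unit circle carries its Borel σ-algebra. -/
instance instMeasurableSpaceCircle : MeasurableSpace Circle := borel Circle

instance instBorelSpaceCircle : BorelSpace Circle := ⟨rfl⟩

/-- The torus `𝕋ⁿ`, with the product topology and the (product = Borel) σ-algebra. -/
abbrev Torus (n : ℕ) : Type := Fin n → Circle

/-- The inclusion `𝕋ⁿ ⊆ ℂⁿ`. -/
def torusCoe {n : ℕ} (ζ : Torus n) : Fin n → ℂ := fun j => (ζ j : ℂ)

/-- The open unit polydisc `𝔻ⁿ`. -/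
def polydisc (n : ℕ) : Set (Fin n → ℂ) := {z | ∀ j, ‖z j‖ < 1}

/-- The normalized Lebesgue measure `mₙ` on `𝕋ⁿ`: the product of the Haar probability measures. -/
def torusMeasure (n : ℕ) : Measure (Torus n) :=
  Measure.pi fun _ => Measure.haarMeasure (⊤ : TopologicalSpace.PositiveCompacts Circle)

/-- The integral `∫ f dμ` of a complex function against a complex measure. -/
def cintegral {X : Type*} [MeasurableSpace X] (μ : ComplexMeasure X) (f : X → ℂ) : ℂ :=
  VectorMeasure.integral μ f (ContinuousLinearMap.mul ℝ ℂ)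

/-- The Cauchy kernel `C(z, w) = ∏ⱼ 1 / (1 - zⱼ w̄ⱼ)`. -/
def cauchyKernel {n : ℕ} (z w : Fin n → ℂ) : ℂ := ∏ j, 1 / (1 - z j * conj (w j))

/-- The Poisson kernel `P(z, ζ) = C(z, ζ) C(ζ, z) / C(z, z)` of the polydisc. -/
def poissonKernel {n : ℕ} (z : Fin n → ℂ) (ζ : Torus n) : ℂ :=
  cauchyKernel z (torusCoe ζ) * cauchyKernel (torusCoe ζ) z / cauchyKernel z z

/-- The Poisson integral `P[μ](z) = ∫ P(z, ζ) dμ(ζ)`. -/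
def poissonIntegral {n : ℕ} (μ : ComplexMeasure (Torus n)) (z : Fin n → ℂ) : ℂ :=
  cintegral μ fun ζ => poissonKernel z ζ

/-- A complex function is pluriharmonic on an open set `Ω ⊆ ℂⁿ` if it is of class `C²` there and
its restriction to every complex line is harmonic. -/
def IsPluriharmonicOn {n : ℕ} (u : (Fin n → ℂ) → ℂ) (Ω : Set (Fin n → ℂ)) : Prop :=
  ContDiffOn ℝ 2 u Ω ∧
    ∀ a b : Fin n → ℂ,
      InnerProductSpace.HarmonicOnNhd (fun lam : ℂ => u (a + lam • b)) {lam : ℂ | a + lam • b ∈ Ω}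

/-- A complex Borel measure on `𝕋ⁿ` is pluriharmonic if its Poisson integral is a pluriharmonic
function on the polydisc. -/
def IsPluriharmonicMeasure {n : ℕ} (μ : ComplexMeasure (Torus n)) : Prop :=
  IsPluriharmonicOn (poissonIntegral μ) (polydisc n)

/-- The circle `𝕋ζ = {ηζ : η ∈ 𝕋} ⊆ 𝕋ⁿ` through `ζ`. -/
def circleThrough {n : ℕ} (ζ : Torus n) : Set (Torus n) :=
  Set.range fun (η : Circle) (j : Fin n) => η * ζ j

/-- `ν` is a slice measure of `μ` at `ζ`: it is supported on the circle `𝕋ζ`, and the slice function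
`λ ↦ P[μ](λζ)` on the unit disc is the Poisson integral of `ν`, where `𝕋ζ` is identified with the
unit circle. The norm in the kernel is the maximum norm of `ℂⁿ`; for `w = ηζ` with `|η| = 1` it
gives `‖w - λζ‖ = |η - λ|`, so that the kernel is the usual Poisson kernel of the disc. -/
structure IsSliceMeasure {n : ℕ} (μ : ComplexMeasure (Torus n)) (ζ : Torus n)
    (ν : ComplexMeasure (Torus n)) : Prop where
  supported : ∀ E : Set (Torus n), MeasurableSet E → Disjoint E (circleThrough ζ) → ν E = 0
  poisson_eq : ∀ lam : ℂ, ‖lam‖ < 1 →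
    poissonIntegral μ (lam • torusCoe ζ) =
      cintegral ν fun w => (((1 - ‖lam‖ ^ 2) / ‖torusCoe w - lam • torusCoe ζ‖ ^ 2 : ℝ) : ℂ)

end TorusSlices

end

/-! Write `u = P[μ]`. By pluriharmonicity each slice function `λ ↦ u(λζ)` is harmonic on the disc,
so its integral means over circles increase with the radius `r`. By Fubini and rotation invariance
of `mₙ`, the average over `ζ` of the mean at radius `r` is the L¹ norm of `ζ ↦ u(rζ)` on the torus,
which is at most a constant depending only on `μ`. Monotone convergence gives an integrable `G` with
all means at `ζ` at most `G ζ` for almost every `ζ` (`exists_integrable_bound`). For such `ζ`, weak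
compactness represents the slice function as the Poisson integral of a measure on the circle
(`exists_poisson_representation`), whose image on `𝕋ζ` is the slice measure.

A slice measure is the weak limit of the dilates of the slice function (`IsSliceMeasure.tendsto`),
hence unique. For the integral formula (`integral_slices`), rotation invariance gives `∫ f(ζ) u(rζ)
dmₙ = ∫∫ f(ηζ) u(rηζ) dη dmₙ(ζ)`. As `r → 1` the left side tends to `∫ f dμ`; on the right the inner
integrals tend to `∫ f dμ_ζ` and are dominated by `‖f‖ G`. -/

noncomputable section

namespace TorusSlices

open Filter Topology Complex

/-! ### Complex measures as combinations of four finite positive measures -/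

section ComplexMeasures

variable {X : Type*} [MeasurableSpace X]

/-- The complex measure `a • ρ` for a finite positive measure `ρ` and `a : ℂ`. -/
def smulMeasure (a : ℂ) (ρ : Measure X) [IsFiniteMeasure ρ] : ComplexMeasure X :=
  ρ.toSignedMeasure.mapRange ((ContinuousLinearMap.toSpanSingleton ℝ a).toLinearMap.toAddMonoidHom)
    (ContinuousLinearMap.toSpanSingleton ℝ a).continuous

lemma smulMeasure_apply (a : ℂ) (ρ : Measure X) [IsFiniteMeasure ρ] {E : Set X}
    (hE : MeasurableSet E) : smulMeasure a ρ E = a * (ρ.real E : ℂ) := by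
  simp [smulMeasure, Measure.toSignedMeasure_apply_measurable hE, mul_comm]

lemma variation_smulMeasure_le (a : ℂ) (ρ : Measure X) [IsFiniteMeasure ρ] :
    (smulMeasure a ρ).variation ≤ ‖a‖₊ • ρ := by
  refine VectorMeasure.variation_le_of_forall_enorm_le fun E hE => ?_
  rw [smulMeasure_apply a ρ hE, enorm_mul, Measure.smul_apply]
  have : ‖(ρ.real E : ℂ)‖ₑ = ρ E := by
    rw [← ofReal_norm, Complex.norm_real, Real.norm_of_nonneg measureReal_nonneg,
      ofReal_measureReal]
  rw [this]
  rfl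

lemma integrable_smulMeasure (a : ℂ) (ρ : Measure X) [IsFiniteMeasure ρ] {f : X → ℂ}
    (hf : Integrable f ρ) : (smulMeasure a ρ).Integrable f :=
  (hf.smul_measure_nnreal (c := ‖a‖₊)).mono_measure (variation_smulMeasure_le a ρ)

/-- Since the variation is at most `‖a‖ ρ`, the left side can be computed as a `setToFun` over `ρ`.
Both sides are then additive and continuous in L¹(ρ), and agree on indicators. -/
lemma cintegral_smulMeasure (a : ℂ) (ρ : Measure X) [IsFiniteMeasure ρ] {f : X → ℂ}
    (hf : Integrable f ρ) : cintegral (smulMeasure a ρ) f = a * ∫ x, f x ∂ρ := by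
  set B := ContinuousLinearMap.mul ℝ ℂ
  have hT : DominatedFinMeasAdditive ρ ((smulMeasure a ρ).transpose B) ‖a‖ := by
    refine ⟨fun s t hs ht _ _ hdisj => cbmApplyMeasure_union _ B hs ht hdisj, fun s hs _ => ?_⟩
    refine (norm_cbmApplyMeasure_le _ B s).trans ?_
    rw [smulMeasure_apply a ρ hs, norm_mul, Complex.norm_real,
      Real.norm_of_nonneg measureReal_nonneg]
    exact (mul_le_mul_of_nonneg_right (ContinuousLinearMap.opNorm_mul_le ℝ ℂ)
      (by positivity)).trans_eq (one_mul _)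
  have h1 : cintegral (smulMeasure a ρ) f = setToFun ρ ((smulMeasure a ρ).transpose B) hT f := by
    exact (setToFun_congr_measure_of_integrable (‖a‖₊ : ENNReal) ENNReal.coe_ne_top
      (variation_smulMeasure_le a ρ) hT
      (dominatedFinMeasAdditive_cbmApplyMeasure _ B) f hf).symm
  rw [h1]
  refine Integrable.induction
    (fun f => setToFun ρ ((smulMeasure a ρ).transpose B) hT f = a * ∫ x, f x ∂ρ) ?_ ?_ ?_ ?_ hf
  · intro c s hs hs'
    rw [setToFun_indicator_const hT hs hs'.ne, integral_indicator_const c hs]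
    change B c (smulMeasure a ρ s) = _
    rw [smulMeasure_apply a ρ hs]
    simp [B]
    ring
  · intro f g _ hf hg hf' hg'
    rw [setToFun_add hT hf hg, hf', hg', ← mul_add, ← integral_add' hf hg]
  · exact isClosed_eq (continuous_setToFun hT) (continuous_const.mul continuous_integral)
  · intro f g hfg hf hf'
    rw [← setToFun_congr_ae hT hfg, hf', integral_congr_ae hfg]

/-- The complex measure `ρ₀ + iρ₁ - ρ₂ - iρ₃`. -/
def combination (ρ : Fin 4 → Measure X) [∀ k, IsFiniteMeasure (ρ k)] : ComplexMeasure X :=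
  ∑ k : Fin 4, smulMeasure (I ^ (k : ℕ)) (ρ k)

lemma combination_apply (ρ : Fin 4 → Measure X) [∀ k, IsFiniteMeasure (ρ k)] {E : Set X}
    (hE : MeasurableSet E) : combination ρ E = ∑ k : Fin 4, I ^ (k : ℕ) * ((ρ k).real E : ℂ) := by
  simp [combination, smulMeasure_apply _ _ hE]

lemma cintegral_combination (ρ : Fin 4 → Measure X) [∀ k, IsFiniteMeasure (ρ k)] {f : X → ℂ}
    (hf : ∀ k, Integrable f (ρ k)) :
    cintegral (combination ρ) f = ∑ k : Fin 4, I ^ (k : ℕ) * ∫ x, f x ∂(ρ k) := by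
  rw [cintegral, combination, VectorMeasure.integral_finsetSum_vectorMeasure]
  · exact Finset.sum_congr rfl fun k _ => cintegral_smulMeasure _ _ (hf k)
  · exact fun k _ => integrable_smulMeasure _ _ (hf k)

/-- Jordan decompositions of the real and imaginary parts, ordered so that the coefficients are the
powers `1, i, -1, -i`. -/
lemma exists_eq_combination (μ : ComplexMeasure X) :
    ∃ ρ : Fin 4 → Measure X, ∃ _ : ∀ k, IsFiniteMeasure (ρ k), μ = combination ρ := by
  let s := (ComplexMeasure.re μ).toJordanDecomposition
  let t := (ComplexMeasure.im μ).toJordanDecomposition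
  have hfin : ∀ k, IsFiniteMeasure (![s.posPart, t.posPart, s.negPart, t.negPart] k) := by
    intro k
    fin_cases k <;> simp <;> infer_instance
  refine ⟨![s.posPart, t.posPart, s.negPart, t.negPart], hfin, ?_⟩
  · have hs : s.toSignedMeasure = ComplexMeasure.re μ :=
      SignedMeasure.toSignedMeasure_toJordanDecomposition _
    have ht : t.toSignedMeasure = ComplexMeasure.im μ :=
      SignedMeasure.toSignedMeasure_toJordanDecomposition _
    ext E hE
    rw [combination_apply _ hE]
    have h1 := congrArg (fun v => v E) hs
    have h2 := congrArg (fun v => v E) ht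
    simp only [JordanDecomposition.toSignedMeasure, FunLike.coe_sub, Pi.sub_apply,
      Measure.toSignedMeasure_apply_measurable hE, ComplexMeasure.re_apply,
      ComplexMeasure.im_apply] at h1 h2
    change _ = (μ E).re at h1
    change _ = (μ E).im at h2
    rw [Fin.sum_univ_four]
    apply Complex.ext <;> simp [← h1, ← h2, pow_succ] <;> ring

lemma exists_eq_combination_supported (μ : ComplexMeasure X) {S : Set X} (hS : MeasurableSet S)
    (h : ∀ E, MeasurableSet E → Disjoint E S → μ E = 0) :
    ∃ ρ : Fin 4 → Measure X, ∃ _ : ∀ k, IsFiniteMeasure (ρ k),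
      μ = combination ρ ∧ ∀ k, ∀ᵐ x ∂(ρ k), x ∈ S := by
  obtain ⟨ρ, _, rfl⟩ := exists_eq_combination μ
  refine ⟨fun k => (ρ k).restrict S, fun k => inferInstance, ?_, fun k => ae_restrict_mem hS⟩
  ext E hE
  have h1 : combination ρ E = combination ρ (E ∩ S) := by
    rw [← Set.inter_union_sdiff E S, VectorMeasure.of_union
      (Set.disjoint_sdiff_right.mono_left Set.inter_subset_right) (hE.inter hS) (hE.diff hS),
      h _ (hE.diff hS) Set.disjoint_sdiff_left]
    simp
  rw [h1, combination_apply _ hE, combination_apply _ (hE.inter hS)]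
  simp [measureReal_restrict_apply hE]

/-- Testing on real `f`, separating real and imaginary parts and moving the negative terms across
reduces the claim to two equalities between finite positive measures. -/
lemma ext_of_cintegral_eq [TopologicalSpace X] [HasOuterApproxClosed X] [BorelSpace X]
    [CompactSpace X] {μ ν : ComplexMeasure X}
    (h : ∀ f : C(X, ℂ), cintegral μ f = cintegral ν f) : μ = ν := by
  obtain ⟨ρ, _, rfl⟩ := exists_eq_combination μ
  obtain ⟨τ, _, rfl⟩ := exists_eq_combination ν
  have key (f : BoundedContinuousFunction X ℝ) :
      (∫ x, f x ∂ρ 0) - (∫ x, f x ∂ρ 2) = (∫ x, f x ∂τ 0) - (∫ x, f x ∂τ 2) ∧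
      (∫ x, f x ∂ρ 1) - (∫ x, f x ∂ρ 3) = (∫ x, f x ∂τ 1) - (∫ x, f x ∂τ 3) := by
    have hf (m : Measure X) [IsFiniteMeasure m] : Integrable (fun x => ((f x : ℝ) : ℂ)) m :=
      (f.integrable m).ofReal
    have := h ⟨fun x => (f x : ℂ), by fun_prop⟩
    simp only [ContinuousMap.coe_mk] at this
    rw [cintegral_combination _ fun k => hf _, cintegral_combination _ fun k => hf _] at this
    simp only [integral_complex_ofReal, Fin.sum_univ_four] at this
    have h1 := congrArg Complex.re this
    have h2 := congrArg Complex.im this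
    simp [pow_succ] at h1 h2
    constructor <;> linarith
  have e1 : ρ 0 + τ 2 = τ 0 + ρ 2 := ext_of_forall_integral_eq_of_IsFiniteMeasure fun f => by
    rw [integral_add_measure (f.integrable _) (f.integrable _),
      integral_add_measure (f.integrable _) (f.integrable _)]
    linarith [(key f).1]
  have e2 : ρ 1 + τ 3 = τ 1 + ρ 3 := ext_of_forall_integral_eq_of_IsFiniteMeasure fun f => by
    rw [integral_add_measure (f.integrable _) (f.integrable _),
      integral_add_measure (f.integrable _) (f.integrable _)]
    linarith [(key f).2]
  ext E hE
  have h1 := congrArg (fun m : Measure X => m.real E) e1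
  have h2 := congrArg (fun m : Measure X => m.real E) e2
  simp only [measureReal_add_apply (measure_ne_top _ _) (measure_ne_top _ _)] at h1 h2
  rw [combination_apply _ hE, combination_apply _ hE]
  apply Complex.ext <;> simp [Fin.sum_univ_four, pow_succ] <;> linarith

end ComplexMeasures

/-! ### Haar measure on the circle and the Poisson kernel of the disc -/

/-- The normalized Haar measure of the unit circle. -/
abbrev circleMeasure : Measure Circle :=
  Measure.haarMeasure (⊤ : TopologicalSpace.PositiveCompacts Circle)

instance : IsProbabilityMeasure circleMeasure :=
  ⟨by simpa using Measure.haarMeasure_self (K₀ := (⊤ : TopologicalSpace.PositiveCompacts Circle))⟩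

lemma torusMeasure_eq (n : ℕ) : torusMeasure n = Measure.pi fun _ => circleMeasure := rfl

instance (n : ℕ) : IsProbabilityMeasure (torusMeasure n) := by
  rw [torusMeasure_eq]; infer_instance

instance (n : ℕ) : (torusMeasure n).IsMulLeftInvariant := by
  rw [torusMeasure_eq]; infer_instance

instance fact_two_pi_pos : Fact (0 < 2 * Real.pi) := ⟨Real.two_pi_pos⟩

lemma circleMeasure_eq_map :
    circleMeasure = (AddCircle.haarAddCircle (T := 2 * Real.pi)).map AddCircle.toCircle := by
  have hm : Measurable (AddCircle.toCircle (T := 2 * Real.pi)) :=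
    AddCircle.continuous_toCircle.measurable
  have : IsProbabilityMeasure
      ((AddCircle.haarAddCircle (T := 2 * Real.pi)).map AddCircle.toCircle) :=
    Measure.isProbabilityMeasure_map hm.aemeasurable
  have : ((AddCircle.haarAddCircle (T := 2 * Real.pi)).map
      AddCircle.toCircle).IsMulLeftInvariant := by
    refine ⟨fun g => ?_⟩
    obtain ⟨t, rfl⟩ := (AddCircle.homeomorphCircle (T := 2 * Real.pi)
      Real.two_pi_pos.ne').surjective g
    rw [AddCircle.homeomorphCircle_apply, Measure.map_map (measurable_const_mul _) hm]
    have : ((fun x => AddCircle.toCircle t * x) ∘ AddCircle.toCircle) =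
        (AddCircle.toCircle (T := 2 * Real.pi)) ∘ fun s => t + s := by
      funext s
      simp [AddCircle.toCircle_add]
    rw [this, ← Measure.map_map hm (measurable_const_add t), map_add_left_eq_self]
  rw [circleMeasure, Measure.haarMeasure_eq_iff]
  simp

/-- Passes from Haar measure to circle averages, the form in which the Poisson formulas are stated.
-/
lemma integral_circleMeasure (F : ℂ → ℂ) :
    ∫ b : Circle, F b ∂circleMeasure = Real.circleAverage F 0 1 := by
  have he : MeasurableEmbedding (AddCircle.toCircle (T := 2 * Real.pi)) := by
    have := (AddCircle.homeomorphCircle (T := 2 * Real.pi) Real.two_pi_pos.ne').measurableEmbedding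
    convert this using 1
    funext t
    exact (AddCircle.homeomorphCircle_apply _ t).symm
  rw [circleMeasure_eq_map, he.integral_map, AddCircle.integral_haarAddCircle, Real.circleAverage,
    ← AddCircle.intervalIntegral_preimage (2 * Real.pi) 0]
  simp [AddCircle.toCircle, circleMap]

lemma circle_dist_eq (a b : Circle) : dist a b = dist (a : ℂ) b :=
  Subtype.dist_eq (p := fun x => x ∈ Metric.sphere (0 : ℂ) 1) a b

/-- The Poisson kernel of the unit disc. -/
def diskKernel (lam : ℂ) (b : Circle) : ℝ := (1 - ‖lam‖ ^ 2) / ‖(b : ℂ) - lam‖ ^ 2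

lemma one_sub_norm_le (lam : ℂ) (b : Circle) : 1 - ‖lam‖ ≤ ‖(b : ℂ) - lam‖ := by
  simpa [Circle.norm_coe] using norm_sub_norm_le (b : ℂ) lam

lemma diskKernel_nonneg {lam : ℂ} (h : ‖lam‖ < 1) (b : Circle) : 0 ≤ diskKernel lam b :=
  div_nonneg (by nlinarith [norm_nonneg lam]) (by positivity)

lemma continuous_diskKernel {Y : Type*} [TopologicalSpace Y] {f : Y → ℂ} {g : Y → Circle}
    (hf : Continuous f) (hg : Continuous g) (h : ∀ y, ‖f y‖ < 1) :
    Continuous fun y => diskKernel (f y) (g y) := by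
  refine Continuous.div (by fun_prop) (by fun_prop) fun y => ?_
  have := one_sub_norm_le (f y) (g y)
  have := h y
  exact pow_ne_zero 2 (by linarith)

/-- On the unit circle `|b - ra| = |a - rb|`. This symmetry lets the kernel be integrated over
either variable. -/
lemma diskKernel_comm (r : ℝ) (a b : Circle) :
    diskKernel (r * a) b = diskKernel (r * b) a := by
  have key : ‖(b : ℂ) - r * a‖ ^ 2 = ‖(a : ℂ) - r * b‖ ^ 2 := by
    have ha := Circle.normSq_coe a
    have hb := Circle.normSq_coe b
    rw [Complex.normSq_apply] at ha hb
    simp only [Complex.sq_norm, Complex.normSq_apply, sub_re, sub_im, mul_re, mul_im, ofReal_re,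
      ofReal_im]
    linear_combination (1 - r ^ 2) * (hb - ha)
  simp [diskKernel, key, Circle.norm_coe]

lemma diskKernel_eq (lam : ℂ) (b : Circle) : diskKernel lam b = _root_.poissonKernel 0 lam b := by
  simp [diskKernel, poissonKernel_def, Circle.norm_coe]

lemma integral_diskKernel_mul_of_diffContOnCl {F : ℂ → ℂ} (hF : DiffContOnCl ℂ F (Metric.ball 0 1))
    {lam : ℂ} (h : ‖lam‖ < 1) :
    ∫ b : Circle, (diskKernel lam b : ℂ) * F b ∂circleMeasure = F lam := by
  rw [← hF.circleAverage_poissonKernel_smul (w := lam) (by simpa using h),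
    ← integral_circleMeasure]
  simp [diskKernel_eq]

lemma integral_diskKernel {lam : ℂ} (h : ‖lam‖ < 1) :
    ∫ b : Circle, diskKernel lam b ∂circleMeasure = 1 := by
  have := integral_diskKernel_mul_of_diffContOnCl (F := fun _ => 1)
    diffContOnCl_const h
  simp only [mul_one] at this
  rw [integral_complex_ofReal] at this
  exact_mod_cast this

lemma continuous_diskKernel_right {lam : ℂ} (h : ‖lam‖ < 1) : Continuous (diskKernel lam) :=
  continuous_diskKernel continuous_const continuous_id fun _ => h

lemma integrable_of_continuous {X E : Type*} [TopologicalSpace X] [CompactSpace X]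
    [MeasurableSpace X] [OpensMeasurableSpace X] [NormedAddCommGroup E]
    [SecondCountableTopologyEither X E] {m : Measure X} [IsFiniteMeasure m] {f : X → E}
    (hf : Continuous f) : Integrable f m := by
  obtain ⟨C, hC⟩ := isCompact_univ.exists_bound_of_continuousOn hf.continuousOn
  exact Integrable.of_bound hf.aestronglyMeasurable C
    (Eventually.of_forall fun x => hC x (Set.mem_univ x))

/-- Since `h` need not extend to the unit circle, the Poisson formula is used on the circle of
radius `s`, at the point `sλ`, and rescaled; real and imaginary parts are treated separately. -/
lemma harmonic_poisson {h : ℂ → ℂ} (hh : InnerProductSpace.HarmonicOnNhd h (Metric.ball 0 1))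
    {s : ℝ} (hs0 : 0 < s) (hs1 : s < 1) {lam : ℂ} (hlam : ‖lam‖ < 1) :
    ∫ b : Circle, (diskKernel lam b : ℂ) * h (s * b) ∂circleMeasure = h (s * lam) := by
  have hmem (b : Circle) : (s : ℂ) * b ∈ Metric.ball (0 : ℂ) 1 := by
    simpa [abs_of_pos hs0, Circle.norm_coe] using hs1
  have real (f : ℂ → ℝ) (hf : InnerProductSpace.HarmonicOnNhd f (Metric.ball 0 1)) :
      ∫ b : Circle, diskKernel lam b * f (s * b) ∂circleMeasure = f (s * lam) := by
    have h1 := (hf.mono (Metric.closedBall_subset_ball hs1)).circleAverage_poissonKernel_smul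
      (w := s * lam) (c := 0) (by simp [abs_of_pos hs0]; nlinarith)
    rw [← h1, Real.circleAverage_eq_circleAverage_zero_one]
    have h2 := integral_circleMeasure
      (fun z => (((1 - ‖lam‖ ^ 2) / ‖z - lam‖ ^ 2 * f (s * z) : ℝ) : ℂ))
    rw [integral_complex_ofReal] at h2
    have h3 : Real.circleAverage (fun z => (((1 - ‖lam‖ ^ 2) / ‖z - lam‖ ^ 2 * f (s * z) : ℝ) : ℂ))
        0 1 = ((Real.circleAverage (fun z => (1 - ‖lam‖ ^ 2) / ‖z - lam‖ ^ 2 * f (s * z)) 0 1 : ℝ)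
          : ℂ) := by
      simp only [Real.circleAverage, intervalIntegral.integral_ofReal]
      simp
    rw [h3] at h2
    have h4 := Complex.ofReal_injective h2
    refine h4.trans (Real.circleAverage_congr_sphere ?_)
    intro z hz
    have hz : ‖z‖ = 1 := by simpa using hz
    have e : ‖(s : ℂ) * z - s * lam‖ = s * ‖z - lam‖ := by
      rw [← mul_sub, norm_mul, Complex.norm_real, Real.norm_of_nonneg hs0.le]
    simp only [Pi.smul_apply', smul_eq_mul, poissonKernel_def, add_zero, sub_zero, e, norm_mul, hz,
      Complex.norm_real, Real.norm_of_nonneg hs0.le]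
    congr 1
    rw [mul_one, mul_pow, mul_pow, ← mul_one_sub, mul_div_mul_left _ _ (by positivity)]
  have hcont : Continuous fun b : Circle => h (s * b) :=
    hh.continuousOn.comp_continuous (by fun_prop) hmem
  have hint : Integrable (fun b : Circle => (diskKernel lam b : ℂ) * h (s * b)) circleMeasure :=
    integrable_of_continuous
      ((continuous_ofReal.comp (continuous_diskKernel_right hlam)).mul hcont)
  apply Complex.ext
  · have := real (fun z => (h z).re) (hh.comp_CLM reCLM)
    rw [← this, ← RCLike.re_eq_complex_re, ← integral_re hint]
    simp
  · have := real (fun z => (h z).im) (hh.comp_CLM imCLM)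
    rw [← this, ← RCLike.im_eq_complex_im, ← integral_im hint]
    simp

/-! ### Approximate identities controlled by second moments -/

/-- A form of uniform continuity that can be integrated: with this bound, a kernel of mass one need
only have a vanishing second moment to be an approximate identity. -/
lemma exists_quadratic_modulus {X : Type*} [PseudoMetricSpace X] [CompactSpace X] (f : C(X, ℂ))
    {ε : ℝ} (hε : 0 < ε) : ∃ C : ℝ, 0 ≤ C ∧ ∀ x y, ‖f x - f y‖ ≤ ε + C * dist x y ^ 2 := by
  obtain ⟨δ, hδ, h⟩ := Metric.uniformContinuous_iff.1
    (CompactSpace.uniformContinuous_of_continuous f.continuous) ε hε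
  refine ⟨2 * ‖f‖ / δ ^ 2, by positivity, fun x y => ?_⟩
  rcases lt_or_ge (dist x y) δ with hxy | hxy
  · have := h hxy
    rw [dist_eq_norm] at this
    have : 0 ≤ 2 * ‖f‖ / δ ^ 2 * dist x y ^ 2 := by positivity
    linarith
  · have h1 : ‖f x - f y‖ ≤ 2 * ‖f‖ := by
      linarith [norm_sub_le (f x) (f y), f.norm_coe_le_norm x, f.norm_coe_le_norm y]
    have h2 : 2 * ‖f‖ ≤ 2 * ‖f‖ / δ ^ 2 * dist x y ^ 2 := by
      rw [div_mul_eq_mul_div, le_div_iff₀ (by positivity)]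
      gcongr
    linarith

lemma tendsto_integral_approximate_identity {X : Type*} [PseudoMetricSpace X] [CompactSpace X]
    [MeasurableSpace X] [BorelSpace X] {m : Measure X} [IsFiniteMeasure m] (f : C(X, ℂ)) (y : X)
    {K : ℕ → X → ℝ} (hK : ∀ j, Continuous (K j)) (hK0 : ∀ j x, 0 ≤ K j x)
    (hK1 : ∀ j, ∫ x, K j x ∂m = 1)
    (hd : Tendsto (fun j => ∫ x, dist x y ^ 2 * K j x ∂m) atTop (𝓝 0)) :
    Tendsto (fun j => ∫ x, f x * (K j x : ℂ) ∂m) atTop (𝓝 (f y)) := by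
  rw [Metric.tendsto_atTop']
  intro ε hε
  obtain ⟨C, hC, hf⟩ := exists_quadratic_modulus f (half_pos hε)
  have h1 : Tendsto (fun j => C * ∫ x, dist x y ^ 2 * K j x ∂m) atTop (𝓝 0) := by
    simpa using hd.const_mul C
  obtain ⟨N, hN⟩ := eventually_atTop.1 (h1.eventually (gt_mem_nhds (half_pos hε)))
  refine ⟨N, fun j hj => ?_⟩
  have i1 : Integrable (fun x => f x * (K j x : ℂ)) m :=
    integrable_of_continuous (f.continuous.mul (continuous_ofReal.comp (hK j)))
  have i2 : Integrable (fun x => f y * (K j x : ℂ)) m :=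
    integrable_of_continuous (continuous_const.mul (continuous_ofReal.comp (hK j)))
  have i3 : Integrable (K j) m := integrable_of_continuous (hK j)
  have i4 : Integrable (fun x => dist x y ^ 2 * K j x) m :=
    integrable_of_continuous (((continuous_id.dist continuous_const).pow 2).mul (hK j))
  have e : f y = ∫ x, f y * (K j x : ℂ) ∂m := by
    rw [integral_const_mul, integral_complex_ofReal, hK1]; simp
  rw [dist_eq_norm, e, ← integral_sub i1 i2]
  calc ‖∫ x, (f x * (K j x : ℂ) - f y * (K j x : ℂ)) ∂m‖
      ≤ ∫ x, (ε / 2 * K j x + C * (dist x y ^ 2 * K j x)) ∂m := by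
        refine norm_integral_le_of_norm_le ((i3.const_mul _).add (i4.const_mul _))
          (Eventually.of_forall fun x => ?_)
        rw [← sub_mul, norm_mul, Complex.norm_real, Real.norm_of_nonneg (hK0 j x)]
        nlinarith [mul_le_mul_of_nonneg_right (hf x y) (hK0 j x)]
    _ = ε / 2 + C * ∫ x, dist x y ^ 2 * K j x ∂m := by
        rw [integral_add (i3.const_mul _) (i4.const_mul _), integral_const_mul, integral_const_mul,
          hK1, mul_one]
    _ < ε := by linarith [hN j (le_of_lt hj)]

/-- On the circle `|b - w|² = Re(2 - 2 b w̄)`, and the kernel reproduces the holomorphic function `2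
- 2 z w̄` at `z = rw`. -/
lemma integral_dist_sq_diskKernel {r : ℝ} (hr0 : 0 ≤ r) (hr1 : r < 1) (w : Circle) :
    ∫ b : Circle, dist b w ^ 2 * diskKernel (r * w) b ∂circleMeasure = 2 - 2 * r := by
  have hn : ‖(r : ℂ) * w‖ < 1 := by simpa [abs_of_nonneg hr0, Circle.norm_coe] using hr1
  have h1 := integral_diskKernel_mul_of_diffContOnCl (F := fun z => 2 - 2 * (z * conj (w : ℂ)))
    (Differentiable.diffContOnCl (by fun_prop)) hn
  have h2 := congrArg Complex.re h1
  rw [← RCLike.re_eq_complex_re, ← integral_re] at h2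
  · have hw : (w : ℂ) * conj (w : ℂ) = 1 := by
      rw [Complex.mul_conj, Circle.normSq_coe]; simp
    rw [mul_assoc, hw] at h2
    simp only [RCLike.re_eq_complex_re] at h2
    rw [show ((2 : ℂ) - 2 * (r * 1)).re = 2 - 2 * r by simp] at h2
    rw [← h2]
    congr 1
    funext b
    have hb := Circle.normSq_coe b
    have hw := Circle.normSq_coe w
    rw [Complex.normSq_apply] at hb hw
    have hd : dist b w = ‖(b : ℂ) - w‖ := by rw [circle_dist_eq, dist_eq_norm]
    rw [hd, Complex.sq_norm, Complex.normSq_apply]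
    simp
    linear_combination (diskKernel (r * w) b) * (hb + hw)
  · exact integrable_of_continuous
      ((continuous_ofReal.comp (continuous_diskKernel_right hn)).mul (by fun_prop))

/-! ### The Poisson kernel of the polydisc as a product of disc kernels -/

/-- The Poisson kernel of the polydisc at the points `(r ζ, w)`. -/
def torusKernel {n : ℕ} (r : ℝ) (ζ w : Torus n) : ℝ := ∏ j, diskKernel (r * ζ j) (w j)

lemma norm_real_mul_coe_lt {r : ℝ} (hr0 : 0 ≤ r) (hr1 : r < 1) (a : Circle) :
    ‖(r : ℂ) * a‖ < 1 := by
  simpa [abs_of_nonneg hr0, Circle.norm_coe] using hr1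

lemma continuous_torusKernel {n : ℕ} {r : ℝ} (hr0 : 0 ≤ r) (hr1 : r < 1) :
    Continuous fun p : Torus n × Torus n => torusKernel r p.1 p.2 :=
  continuous_finsetProd _ fun j _ => continuous_diskKernel (by fun_prop) (by fun_prop)
    fun _ => norm_real_mul_coe_lt hr0 hr1 _

lemma continuous_torusKernel_left {n : ℕ} {r : ℝ} (hr0 : 0 ≤ r) (hr1 : r < 1) (w : Torus n) :
    Continuous fun ζ : Torus n => torusKernel r ζ w :=
  continuous_finsetProd _ fun j _ => continuous_diskKernel (by fun_prop) continuous_const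
    fun _ => norm_real_mul_coe_lt hr0 hr1 _

lemma torusKernel_nonneg {n : ℕ} {r : ℝ} (hr0 : 0 ≤ r) (hr1 : r < 1) (ζ w : Torus n) :
    0 ≤ torusKernel r ζ w :=
  Finset.prod_nonneg fun _ _ => diskKernel_nonneg (norm_real_mul_coe_lt hr0 hr1 _) _

lemma torusKernel_comm {n : ℕ} (r : ℝ) (ζ w : Torus n) :
    torusKernel r ζ w = torusKernel r w ζ :=
  Finset.prod_congr rfl fun _ _ => diskKernel_comm r _ _

lemma integral_torusKernel {n : ℕ} {r : ℝ} (hr0 : 0 ≤ r) (hr1 : r < 1) (w : Torus n) :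
    ∫ ζ, torusKernel r ζ w ∂torusMeasure n = 1 := by
  simp_rw [torusKernel_comm r _ w, torusKernel]
  rw [torusMeasure_eq, integral_fintype_prod_eq_prod]
  exact Finset.prod_eq_one fun j _ => integral_diskKernel (norm_real_mul_coe_lt hr0 hr1 _)

/-- The integral factors: coordinate `j` gives the second moment on the circle, every other
coordinate gives one. -/
lemma integral_dist_coord_sq_torusKernel {n : ℕ} {r : ℝ} (hr0 : 0 ≤ r) (hr1 : r < 1) (w : Torus n)
    (j : Fin n) : ∫ ζ, dist (ζ j) (w j) ^ 2 * torusKernel r ζ w ∂torusMeasure n = 2 - 2 * r := by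
  have e (ζ : Torus n) : dist (ζ j) (w j) ^ 2 * torusKernel r ζ w =
      ∏ i, (if i = j then dist (ζ i) (w i) ^ 2 else 1) * diskKernel (r * w i) (ζ i) := by
    rw [Finset.prod_mul_distrib, torusKernel_comm, torusKernel]
    simp
  simp_rw [e]
  rw [torusMeasure_eq, integral_fintype_prod_eq_prod
    (f := fun i b => (if i = j then dist b (w i) ^ 2 else 1) * diskKernel (r * w i) b),
    Finset.prod_eq_single j]
  · simpa using integral_dist_sq_diskKernel hr0 hr1 (w j)
  · intro i _ hij
    simpa [hij] using integral_diskKernel (norm_real_mul_coe_lt hr0 hr1 _)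
  · simp

lemma dist_sq_le_sum {n : ℕ} (ζ w : Torus n) : dist ζ w ^ 2 ≤ ∑ j, dist (ζ j) (w j) ^ 2 := by
  have h0 : 0 ≤ ∑ j, dist (ζ j) (w j) ^ 2 := Finset.sum_nonneg fun _ _ => by positivity
  have : dist ζ w ≤ √(∑ j, dist (ζ j) (w j) ^ 2) := by
    refine (dist_pi_le_iff (Real.sqrt_nonneg _)).2 fun j => Real.le_sqrt_of_sq_le ?_
    exact Finset.single_le_sum (f := fun j => dist (ζ j) (w j) ^ 2)
      (fun _ _ => by positivity) (Finset.mem_univ j)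
  calc dist ζ w ^ 2 ≤ √(∑ j, dist (ζ j) (w j) ^ 2) ^ 2 := by gcongr
    _ = _ := Real.sq_sqrt h0

lemma integral_dist_sq_torusKernel_le {n : ℕ} {r : ℝ} (hr0 : 0 ≤ r) (hr1 : r < 1) (w : Torus n) :
    ∫ ζ, dist ζ w ^ 2 * torusKernel r ζ w ∂torusMeasure n ≤ n * (2 - 2 * r) := by
  have hc : Continuous fun ζ : Torus n => torusKernel r ζ w :=
    continuous_torusKernel_left hr0 hr1 w
  have hi (j : Fin n) : Integrable (fun ζ : Torus n => dist (ζ j) (w j) ^ 2 * torusKernel r ζ w)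
      (torusMeasure n) := integrable_of_continuous
        ((((continuous_apply j).dist continuous_const).pow 2).mul hc)
  have hi' : Integrable (fun ζ => dist ζ w ^ 2 * torusKernel r ζ w) (torusMeasure n) :=
    integrable_of_continuous (((continuous_id.dist continuous_const).pow 2).mul hc)
  have h1 : ∫ ζ, ∑ j, dist (ζ j) (w j) ^ 2 * torusKernel r ζ w ∂torusMeasure n =
      n * (2 - 2 * r) := by
    rw [integral_finsetSum _ fun j _ => hi j]
    simp only [integral_dist_coord_sq_torusKernel hr0 hr1, Finset.sum_const, Finset.card_univ,
      Fintype.card_fin, nsmul_eq_mul]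
  rw [← h1]
  refine integral_mono hi' (integrable_finsetSum Finset.univ fun j _ => hi j) fun ζ => ?_
  beta_reduce
  rw [← Finset.sum_mul]
  exact mul_le_mul_of_nonneg_right (dist_sq_le_sum ζ w) (torusKernel_nonneg hr0 hr1 _ _)

lemma poissonKernel_smul_torusCoe {n : ℕ} (r : ℝ) (ζ w : Torus n) :
    poissonKernel ((r : ℂ) • torusCoe ζ) w = (torusKernel r ζ w : ℂ) := by
  rw [poissonKernel, cauchyKernel, cauchyKernel, cauchyKernel, ← Finset.prod_mul_distrib,
    ← Finset.prod_div_distrib, torusKernel, ofReal_prod]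
  refine Finset.prod_congr rfl fun j _ => ?_
  set z : ℂ := r * ζ j
  set b : ℂ := ((w j : Circle) : ℂ)
  have hb : b * conj b = 1 := by
    rw [Complex.mul_conj, Circle.normSq_coe]; simp
  have e1 : ((‖z‖ ^ 2 : ℝ) : ℂ) = z * conj z := by
    rw [Complex.mul_conj, Complex.sq_norm]
  -- Uses `|b| = 1`; it identifies each Cauchy-kernel factor with the disc kernel.
  have e2 : ((‖b - z‖ ^ 2 : ℝ) : ℂ) = (1 - z * conj b) * (1 - b * conj z) := by
    rw [Complex.sq_norm, ← Complex.mul_conj, map_sub]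
    linear_combination (1 - z * conj z) * hb
  have hz : ((r : ℂ) • torusCoe ζ) j = z := rfl
  have hw : torusCoe w j = b := rfl
  rw [hz, hw, diskKernel, ofReal_div, e2, ofReal_sub, e1, ofReal_one]
  rw [one_div, one_div, one_div, div_inv_eq_mul, ← mul_inv, mul_comm, div_eq_mul_inv]

/-- A sequence of radii increasing to `1`. -/
def radius (j : ℕ) : ℝ := 1 - 1 / ((j : ℝ) + 2)

/-- The shift by 2 makes the first radius `1/2`; `harmonic_poisson` needs a positive one. -/
lemma radius_pos (j : ℕ) : 0 < radius j := by
  have : (1 : ℝ) / (j + 2) < 1 := by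
    rw [div_lt_one (by positivity)]
    have : (0 : ℝ) ≤ j := by positivity
    linarith
  unfold radius
  linarith

lemma radius_lt_one (j : ℕ) : radius j < 1 := by
  have : (0 : ℝ) < 1 / (j + 2) := by positivity
  unfold radius
  linarith

lemma radius_mono : Monotone radius := by
  intro i j hij
  unfold radius
  gcongr

lemma tendsto_radius : Tendsto radius atTop (𝓝 1) := by
  have h := tendsto_const_div_atTop_nhds_zero_nat (1 : ℝ)
  have h2 := ((tendsto_add_atTop_iff_nat 2).2 h).const_sub 1
  rw [show radius = fun j : ℕ => 1 - 1 / ((j : ℝ) + 2) from rfl]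
  simpa using h2

/-! ### Weak convergence of kernel integrals -/

section Kernels

variable {Y W : Type*} [TopologicalSpace Y] [CompactSpace Y] [MeasurableSpace Y] [BorelSpace Y]
  [SecondCountableTopology Y] [TopologicalSpace W] [CompactSpace W] [MeasurableSpace W]
  [BorelSpace W] [SecondCountableTopology W]

/-- If kernels `K j` are approximate identities at almost every `w`, the functions obtained by
integrating them in `w` converge weakly to the complex measure `ρ₀ + iρ₁ - ρ₂ - iρ₃`. -/
lemma tendsto_integral_mul_kernel_integral {m : Measure Y} [IsFiniteMeasure m]
    (ρ : Fin 4 → Measure W) [∀ k, IsFiniteMeasure (ρ k)] {K : ℕ → Y → W → ℝ}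
    (hK : ∀ j, Continuous (Function.uncurry (K j))) (g : C(Y, ℂ)) {F : W → ℂ}
    (h0 : ∀ k, ∀ᵐ w ∂ρ k, ∀ j y, 0 ≤ K j y w)
    (h1 : ∀ k, ∀ᵐ w ∂ρ k, ∀ j, ∫ y, K j y w ∂m = 1)
    (hlim : ∀ k, ∀ᵐ w ∂ρ k, Tendsto (fun j => ∫ y, g y * (K j y w : ℂ) ∂m) atTop (𝓝 (F w))) :
    Tendsto (fun j => ∫ y, g y * ∑ k : Fin 4, I ^ (k : ℕ) * ∫ w, (K j y w : ℂ) ∂ρ k ∂m) atTop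
      (𝓝 (∑ k : Fin 4, I ^ (k : ℕ) * ∫ w, F w ∂ρ k)) := by
  have hcont (j : ℕ) : Continuous fun p : Y × W => g p.1 * (K j p.1 p.2 : ℂ) :=
    (g.continuous.comp continuous_fst).mul (continuous_ofReal.comp (hK j))
  have hint (j : ℕ) (k : Fin 4) :
      Integrable (Function.uncurry fun y w => g y * (K j y w : ℂ)) (m.prod (ρ k)) :=
    integrable_of_continuous (hcont j)
  have hswap (j : ℕ) : ∫ y, g y * ∑ k : Fin 4, I ^ (k : ℕ) * ∫ w, (K j y w : ℂ) ∂ρ k ∂m =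
      ∑ k : Fin 4, I ^ (k : ℕ) * ∫ w, ∫ y, g y * (K j y w : ℂ) ∂m ∂ρ k := by
    have e (y : Y) : g y * ∑ k : Fin 4, I ^ (k : ℕ) * ∫ w, (K j y w : ℂ) ∂ρ k =
        ∑ k : Fin 4, I ^ (k : ℕ) * ∫ w, g y * (K j y w : ℂ) ∂ρ k := by
      rw [Finset.mul_sum]
      refine Finset.sum_congr rfl fun k _ => ?_
      rw [integral_const_mul]
      ring
    simp_rw [e]
    rw [integral_finsetSum]
    · refine Finset.sum_congr rfl fun k _ => ?_
      rw [integral_const_mul, integral_integral_swap (hint j k)]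
    · exact fun k _ => ((hint j k).integral_prod_left).const_mul _
  simp_rw [hswap]
  refine tendsto_finsetSum _ fun k _ => Tendsto.const_mul _ ?_
  -- After Fubini the inner integrals average `g` against probability densities, so `‖g‖` dominates.
  refine tendsto_integral_of_dominated_convergence (fun _ => ‖g‖)
    (fun j => (hint j k).integral_prod_right.aestronglyMeasurable) (integrable_const _) ?_ (hlim k)
  intro j
  filter_upwards [h0 k, h1 k] with w hw0 hw1
  have hc : Continuous fun y => K j y w :=
    (hK j).comp (continuous_id.prodMk continuous_const)
  calc ‖∫ y, g y * (K j y w : ℂ) ∂m‖ ≤ ∫ y, ‖g‖ * K j y w ∂m := by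
        refine norm_integral_le_of_norm_le ((integrable_of_continuous hc).const_mul _)
          (Eventually.of_forall fun y => ?_)
        rw [norm_mul, Complex.norm_real, Real.norm_of_nonneg (hw0 j y)]
        exact mul_le_mul_of_nonneg_right (g.norm_coe_le_norm y) (hw0 j y)
    _ = ‖g‖ := by rw [integral_const_mul, hw1, mul_one]

end Kernels

/-! ### Harmonic functions on the disc with bounded integral means -/

section Disk

variable {h : ℂ → ℂ}

lemma continuous_comp_real_mul_circle (hh : ContinuousOn h (Metric.ball 0 1)) {r : ℝ}
    (hr0 : 0 ≤ r) (hr1 : r < 1) : Continuous fun b : Circle => h (r * b) :=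
  hh.comp_continuous (by fun_prop) fun b => by simpa using norm_real_mul_coe_lt hr0 hr1 b

/-- The integral means of a harmonic function over circles increase with the radius. -/
lemma integral_norm_circle_mono (hh : InnerProductSpace.HarmonicOnNhd h (Metric.ball 0 1))
    {r s : ℝ} (hr0 : 0 ≤ r) (hrs : r ≤ s) (hs1 : s < 1) :
    ∫ b : Circle, ‖h (r * b)‖ ∂circleMeasure ≤ ∫ b : Circle, ‖h (s * b)‖ ∂circleMeasure := by
  rcases hrs.eq_or_lt with rfl | hrs
  · rfl
  have hs0 : 0 < s := hr0.trans_lt hrs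
  have ht0 : 0 ≤ r / s := by positivity
  have ht1 : r / s < 1 := (div_lt_one hs0).2 hrs
  have hcr := continuous_comp_real_mul_circle hh.continuousOn hr0 (hrs.trans hs1)
  have hcs := continuous_comp_real_mul_circle hh.continuousOn hs0.le hs1
  have hk : Continuous fun p : Circle × Circle => diskKernel ((r / s : ℝ) * p.1) p.2 :=
    continuous_diskKernel (by fun_prop) (by fun_prop) fun _ => norm_real_mul_coe_lt ht0 ht1 _
  have hint : Integrable (Function.uncurry fun a b : Circle =>
      diskKernel ((r / s : ℝ) * a) b * ‖h (s * b)‖) (circleMeasure.prod circleMeasure) :=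
    integrable_of_continuous (hk.mul (hcs.norm.comp continuous_snd))
  -- The point `ra` is `s` times `(r/s)a`, so the value there is a Poisson average over the circle
  -- of radius `s`.
  have hpt (a : Circle) : ‖h (r * a)‖ ≤
      ∫ b : Circle, diskKernel ((r / s : ℝ) * a) b * ‖h (s * b)‖ ∂circleMeasure := by
    have hlam := norm_real_mul_coe_lt ht0 ht1 a
    have e : (s : ℂ) * ((r / s : ℝ) * a) = r * a := by
      have : (s : ℂ) ≠ 0 := by exact_mod_cast hs0.ne'
      push_cast
      field_simp
    rw [← e, ← harmonic_poisson hh hs0 hs1 hlam]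
    refine (norm_integral_le_integral_norm _).trans_eq (integral_congr_ae
      (Eventually.of_forall fun b => ?_))
    simp only [norm_mul, Complex.norm_real, Real.norm_of_nonneg (diskKernel_nonneg hlam b)]
  calc ∫ a : Circle, ‖h (r * a)‖ ∂circleMeasure
      ≤ ∫ a : Circle, ∫ b : Circle, diskKernel ((r / s : ℝ) * a) b * ‖h (s * b)‖
          ∂circleMeasure ∂circleMeasure :=
        integral_mono (integrable_of_continuous hcr.norm) hint.integral_prod_left hpt
    _ = ∫ b : Circle, ‖h (s * b)‖ ∂circleMeasure := by
        rw [integral_integral_swap hint]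
        refine integral_congr_ae (Eventually.of_forall fun b => ?_)
        simp only
        simp_rw [diskKernel_comm (r / s) _ b]
        rw [integral_mul_const, integral_diskKernel (norm_real_mul_coe_lt ht0 ht1 b), one_mul]

/-- The four nonnegative parts of a complex number. -/
def part (k : Fin 4) (z : ℂ) : ℝ := ![max z.re 0, max z.im 0, max (-z.re) 0, max (-z.im) 0] k

lemma part_nonneg (k : Fin 4) (z : ℂ) : 0 ≤ part k z := by
  fin_cases k <;> simp [part]

lemma part_le_norm (k : Fin 4) (z : ℂ) : part k z ≤ ‖z‖ := by
  have h1 := abs_le.1 (abs_re_le_norm z)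
  have h2 := abs_le.1 (abs_im_le_norm z)
  fin_cases k <;> simp [part] <;> linarith

lemma continuous_part (k : Fin 4) : Continuous (part k) := by
  unfold part
  fin_cases k <;> simp <;> fun_prop

lemma sum_part (z : ℂ) : ∑ k : Fin 4, I ^ (k : ℕ) * (part k z : ℂ) = z := by
  have (x : ℝ) : max x 0 - max (-x) 0 = x := max_zero_sub_max_neg_zero_eq_self x
  apply Complex.ext
  · simpa [Fin.sum_univ_four, part, pow_succ, sub_eq_add_neg] using! this z.re
  · simpa [Fin.sum_univ_four, part, pow_succ, sub_eq_add_neg] using! this z.im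

/-- A harmonic function on the disc with bounded integral means is the Poisson integral of a
complex measure on the circle. -/
lemma exists_poisson_representation (hh : InnerProductSpace.HarmonicOnNhd h (Metric.ball 0 1))
    {C : ℝ} (hC : ∀ j, ∫ b : Circle, ‖h (radius j * b)‖ ∂circleMeasure ≤ C) :
    ∃ ρ : Fin 4 → Measure Circle, ∃ _ : ∀ k, IsFiniteMeasure (ρ k), ∀ lam : ℂ, ‖lam‖ < 1 →
      h lam = ∑ k : Fin 4, I ^ (k : ℕ) * ((∫ b, diskKernel lam b ∂ρ k : ℝ) : ℂ) := by
  have hcont (j : ℕ) : Continuous fun b : Circle => h (radius j * b) :=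
    continuous_comp_real_mul_circle hh.continuousOn (radius_pos j).le (radius_lt_one j)
  have hpc (k : Fin 4) (j : ℕ) : Continuous fun b : Circle => part k (h (radius j * b)) :=
    (continuous_part k).comp (hcont j)
  have hpi (k : Fin 4) (j : ℕ) :
      Integrable (fun b : Circle => part k (h (radius j * b))) circleMeasure :=
    integrable_of_continuous (hpc k j)
  -- The four parts of `h` on the circle of radius `radius j`, taken as densities; their masses are
  -- bounded by `C`.
  let N (k : Fin 4) (j : ℕ) : FiniteMeasure Circle :=
    ⟨circleMeasure.withDensity fun b => ENNReal.ofReal (part k (h (radius j * b))),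
      isFiniteMeasure_withDensity_ofReal (hpi k j).2⟩
  have hmass (k : Fin 4) (j : ℕ) : (N k j).mass ≤ C.toNNReal := by
    have : ((N k j).mass : ENNReal) ≤ ENNReal.ofReal C := by
      rw [FiniteMeasure.ennreal_mass]
      change (circleMeasure.withDensity _) Set.univ ≤ _
      rw [withDensity_apply _ MeasurableSet.univ, Measure.restrict_univ,
        ← ofReal_integral_eq_lintegral_ofReal (hpi k j)
          (Eventually.of_forall fun _ => part_nonneg _ _)]
      refine ENNReal.ofReal_le_ofReal (le_trans ?_ (hC j))
      exact integral_mono (hpi k j) (integrable_of_continuous (hcont j).norm)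
        fun b => part_le_norm k _
    exact ENNReal.coe_le_coe.1 this
  -- An ultrafilter replaces the choice of a subsequence and serves all four parts at once.
  let U : Ultrafilter ℕ := hyperfilter ℕ
  have hU : (U : Filter ℕ) ≤ atTop := by
    rw [← Nat.cofinite_eq_atTop]; exact hyperfilter_le_cofinite
  have hex (k : Fin 4) : ∃ ν : FiniteMeasure Circle, Tendsto (N k) U (𝓝 ν) := by
    obtain ⟨ν, -, hν⟩ := (isCompact_setOfPred_finiteMeasure_le_of_compactSpace Circle
      C.toNNReal).ultrafilter_le_nhds (U.map (N k)) (by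
        rw [le_principal_iff]
        exact mem_map.2 (univ_mem' (hmass k)))
    exact ⟨ν, hν⟩
  choose ν hν using hex
  refine ⟨fun k => (ν k : Measure Circle), fun k => inferInstance, fun lam hlam => ?_⟩
  have hq : Continuous (diskKernel lam) := continuous_diskKernel_right hlam
  have hlim1 : Tendsto (fun j => ∑ k : Fin 4, I ^ (k : ℕ) *
      ((∫ b, diskKernel lam b ∂(N k j : Measure Circle) : ℝ) : ℂ)) U
      (𝓝 (∑ k : Fin 4, I ^ (k : ℕ) * ((∫ b, diskKernel lam b ∂(ν k : Measure Circle) : ℝ) : ℂ))) :=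
    tendsto_finsetSum _ fun k _ => ((continuous_ofReal.tendsto _).comp
      (FiniteMeasure.tendsto_iff_forall_integral_tendsto.1 (hν k)
        (BoundedContinuousFunction.mkOfCompact ⟨_, hq⟩))).const_mul _
  have heq (j : ℕ) : ∑ k : Fin 4, I ^ (k : ℕ) *
      ((∫ b, diskKernel lam b ∂(N k j : Measure Circle) : ℝ) : ℂ) = h (radius j * lam) := by
    rw [← harmonic_poisson hh (radius_pos j) (radius_lt_one j) hlam]
    have e (b : Circle) : (diskKernel lam b : ℂ) * h (radius j * b) =
        ∑ k : Fin 4, I ^ (k : ℕ) * ((part k (h (radius j * b)) * diskKernel lam b : ℝ) : ℂ) := by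
      nth_rw 1 [← sum_part (h (radius j * b))]
      rw [Finset.mul_sum]
      refine Finset.sum_congr rfl fun k _ => ?_
      push_cast
      ring
    simp_rw [e]
    rw [integral_finsetSum]
    · refine Finset.sum_congr rfl fun k _ => ?_
      rw [integral_const_mul, integral_complex_ofReal]
      congr 2
      change ∫ b, diskKernel lam b ∂(circleMeasure.withDensity _) = _
      rw [integral_withDensity_eq_integral_toReal_smul (hpc k j).measurable.ennreal_ofReal
        (Eventually.of_forall fun _ => ENNReal.ofReal_lt_top)]
      simp [ENNReal.toReal_ofReal (part_nonneg _ _)]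
    · exact fun k _ => (Integrable.ofReal (integrable_of_continuous ((hpc k j).mul hq))).const_mul _
  have hlim2 : Tendsto (fun j => h (radius j * lam)) U (𝓝 (h lam)) := by
    have h1 : ContinuousAt h lam :=
      hh.continuousOn.continuousAt (Metric.isOpen_ball.mem_nhds (by simpa using hlam))
    have h2 : Tendsto (fun j => (radius j : ℂ) * lam) atTop (𝓝 lam) := by
      simpa using ((continuous_ofReal.tendsto 1).comp tendsto_radius).mul_const lam
    exact (h1.tendsto.comp h2).mono_left hU
  simp_rw [heq] at hlim1
  exact tendsto_nhds_unique hlim2 hlim1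

end Disk

/-! ### Rotations of the torus and slice functions -/

/-- The point `ηζ` of the circle through `ζ`. -/
def rotate {n : ℕ} (η : Circle) (ζ : Torus n) : Torus n := fun j => η * ζ j

variable {n : ℕ}

lemma continuous_rotate : Continuous fun p : Circle × Torus n => rotate p.1 p.2 := by
  unfold rotate
  fun_prop

lemma continuous_rotate_left (ζ : Torus n) : Continuous fun η : Circle => rotate η ζ := by
  unfold rotate
  fun_prop

lemma continuous_torusCoe : Continuous (torusCoe (n := n)) := by
  unfold torusCoe
  fun_prop

lemma smul_torusCoe_rotate (r : ℝ) (η : Circle) (ζ : Torus n) :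
    (r : ℂ) • torusCoe (rotate η ζ) = ((r : ℂ) * η) • torusCoe ζ := by
  funext j
  simp [torusCoe, rotate, mul_assoc]

lemma integral_rotate {E : Type*} [NormedAddCommGroup E] [NormedSpace ℝ E] {F : Torus n → E}
    (η : Circle) :
    ∫ ζ, F (rotate η ζ) ∂torusMeasure n = ∫ ζ, F ζ ∂torusMeasure n :=
  integral_mul_left_eq_self F fun _ => η

lemma integral_integral_rotate {E : Type*} [NormedAddCommGroup E] [NormedSpace ℝ E]
    [CompleteSpace E] {F : Torus n → E} (hF : Continuous F) :
    ∫ ζ, ∫ η, F (rotate η ζ) ∂circleMeasure ∂torusMeasure n = ∫ ζ, F ζ ∂torusMeasure n := by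
  rw [integral_integral_swap]
  · simp_rw [integral_rotate]
    simp
  · exact integrable_of_continuous
      (hF.comp (continuous_rotate.comp (continuous_snd.prodMk continuous_fst)))

lemma smul_torusCoe_mem_polydisc {lam : ℂ} (h : ‖lam‖ < 1) (ζ : Torus n) :
    lam • torusCoe ζ ∈ polydisc n := fun j => by
  simpa [torusCoe, Circle.norm_coe] using h

lemma IsPluriharmonicOn.harmonic_slice {u : (Fin n → ℂ) → ℂ}
    (hu : IsPluriharmonicOn u (polydisc n)) (ζ : Torus n) :
    InnerProductSpace.HarmonicOnNhd (fun lam : ℂ => u (lam • torusCoe ζ)) (Metric.ball 0 1) := by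
  have h := hu.2 0 (torusCoe ζ)
  simp only [zero_add] at h
  exact h.mono fun lam hlam => smul_torusCoe_mem_polydisc (by simpa using hlam) ζ

lemma continuous_comp_smul_torusCoe {u : (Fin n → ℂ) → ℂ} (hu : ContinuousOn u (polydisc n))
    {r : ℝ} (hr0 : 0 ≤ r) (hr1 : r < 1) :
    Continuous fun ζ : Torus n => u ((r : ℂ) • torusCoe ζ) :=
  hu.comp_continuous (continuous_torusCoe.const_smul (r : ℂ)) fun ζ =>
    smul_torusCoe_mem_polydisc (by simpa [abs_of_nonneg hr0] using hr1) ζ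

/-! ### Poisson integrals on the torus: L¹ bound and boundary values -/

section PoissonIntegral

variable (ρ : Fin 4 → Measure (Torus n)) [∀ k, IsFiniteMeasure (ρ k)]

lemma continuous_torusKernel_right {r : ℝ} (hr0 : 0 ≤ r) (hr1 : r < 1) (ζ : Torus n) :
    Continuous fun w : Torus n => torusKernel r ζ w := by
  simp_rw [torusKernel_comm r ζ]
  exact continuous_torusKernel_left hr0 hr1 ζ

lemma poissonIntegral_combination {r : ℝ} (hr0 : 0 ≤ r) (hr1 : r < 1) (ζ : Torus n) :
    poissonIntegral (combination ρ) ((r : ℂ) • torusCoe ζ) =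
      ∑ k : Fin 4, I ^ (k : ℕ) * ∫ w, (torusKernel r ζ w : ℂ) ∂ρ k := by
  simp_rw [poissonIntegral, poissonKernel_smul_torusCoe]
  exact cintegral_combination ρ fun k => integrable_of_continuous
    (continuous_ofReal.comp (continuous_torusKernel_right hr0 hr1 ζ))

/-- The kernel is nonnegative with integral one in `ζ`, so integrating over `ζ` before `w` leaves
the masses of the `ρ k`, whatever `r` is. -/
lemma integral_norm_poissonIntegral_le
    (hu : ContinuousOn (poissonIntegral (combination ρ)) (polydisc n)) {r : ℝ}
    (hr0 : 0 ≤ r) (hr1 : r < 1) :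
    ∫ ζ, ‖poissonIntegral (combination ρ) ((r : ℂ) • torusCoe ζ)‖ ∂torusMeasure n ≤
      ∑ k, (ρ k).real Set.univ := by
  have hint (k : Fin 4) : Integrable (Function.uncurry fun ζ w : Torus n => torusKernel r ζ w)
      ((torusMeasure n).prod (ρ k)) := integrable_of_continuous (continuous_torusKernel hr0 hr1)
  calc ∫ ζ, ‖poissonIntegral (combination ρ) ((r : ℂ) • torusCoe ζ)‖ ∂torusMeasure n
      ≤ ∫ ζ, ∑ k, ∫ w, torusKernel r ζ w ∂ρ k ∂torusMeasure n := by
        refine integral_mono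
          (integrable_of_continuous (continuous_comp_smul_torusCoe hu hr0 hr1).norm)
          (integrable_finsetSum _ fun k _ => (hint k).integral_prod_left) fun ζ => ?_
        beta_reduce
        rw [poissonIntegral_combination ρ hr0 hr1]
        refine (norm_sum_le _ _).trans (Finset.sum_le_sum fun k _ => ?_)
        rw [integral_complex_ofReal, norm_mul, norm_pow, norm_I, one_pow, one_mul,
          Complex.norm_real, Real.norm_of_nonneg
            (integral_nonneg fun w => torusKernel_nonneg hr0 hr1 ζ w)]
    _ = ∑ k, (ρ k).real Set.univ := by
        refine (integral_finsetSum _ fun k _ => (hint k).integral_prod_left).trans ?_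
        refine Finset.sum_congr rfl fun k _ => ?_
        refine (integral_integral_swap (hint k)).trans ?_
        simp_rw [integral_torusKernel hr0 hr1]
        simp

/-- The dilates of the Poisson integral of a complex measure converge weakly to the measure. -/
lemma tendsto_integral_mul_poissonIntegral (f : C(Torus n, ℂ)) :
    Tendsto (fun j => ∫ ζ, f ζ * poissonIntegral (combination ρ)
      ((radius j : ℂ) • torusCoe ζ) ∂torusMeasure n) atTop (𝓝 (cintegral (combination ρ) f)) := by
  rw [cintegral_combination ρ fun k => integrable_of_continuous f.continuous]
  have e (j : ℕ) (ζ : Torus n) :=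
    poissonIntegral_combination ρ (radius_pos j).le (radius_lt_one j) ζ
  simp_rw [e]
  refine tendsto_integral_mul_kernel_integral ρ
    (K := fun j ζ w => torusKernel (radius j) ζ w)
    (fun j => continuous_torusKernel (radius_pos j).le (radius_lt_one j)) f
    (fun k => Eventually.of_forall fun w j ζ =>
      torusKernel_nonneg (radius_pos j).le (radius_lt_one j) ζ w)
    (fun k => Eventually.of_forall fun w j =>
      integral_torusKernel (radius_pos j).le (radius_lt_one j) w)
    (fun k => Eventually.of_forall fun w => ?_)
  refine tendsto_integral_approximate_identity f w
    (fun j => continuous_torusKernel_left (radius_pos j).le (radius_lt_one j) w)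
    (fun j ζ => torusKernel_nonneg (radius_pos j).le (radius_lt_one j) ζ w)
    (fun j => integral_torusKernel (radius_pos j).le (radius_lt_one j) w) ?_
  refine squeeze_zero (fun j => integral_nonneg fun ζ => mul_nonneg (by positivity)
      (torusKernel_nonneg (radius_pos j).le (radius_lt_one j) ζ w))
    (fun j => integral_dist_sq_torusKernel_le (radius_pos j).le (radius_lt_one j) w) ?_
  have := ((tendsto_radius.const_mul 2).const_sub 2).const_mul (n : ℝ)
  simpa using this

end PoissonIntegral

/-! ### Slice measures: existence, uniqueness, integration -/

section Slices

/-- The kernel of the slice at `ζ`. -/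
def sliceKernel (lam : ℂ) (ζ w : Torus n) : ℝ :=
  (1 - ‖lam‖ ^ 2) / ‖torusCoe w - lam • torusCoe ζ‖ ^ 2

lemma one_sub_norm_le_norm_torusCoe_sub [NeZero n] (lam : ℂ) (ζ w : Torus n) :
    1 - ‖lam‖ ≤ ‖torusCoe w - lam • torusCoe ζ‖ := by
  have h1 := norm_le_pi_norm (torusCoe w - lam • torusCoe ζ) 0
  have h2 := norm_sub_norm_le (torusCoe w 0) ((lam • torusCoe ζ) 0)
  have h3 : ‖torusCoe w 0‖ = 1 := Circle.norm_coe _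
  have h4 : ‖(lam • torusCoe ζ) 0‖ = ‖lam‖ := by
    simp [torusCoe, Circle.norm_coe]
  rw [h3, h4] at h2
  exact h2.trans h1

lemma continuous_sliceKernel [NeZero n] (ζ : Torus n) {Z : Type*} [TopologicalSpace Z] {f : Z → ℂ}
    {g : Z → Torus n} (hf : Continuous f) (hg : Continuous g) (h : ∀ z, ‖f z‖ < 1) :
    Continuous fun z => sliceKernel (f z) ζ (g z) := by
  refine Continuous.div (by fun_prop)
    (((continuous_torusCoe.comp hg).sub (hf.smul continuous_const)).norm.pow 2) fun z => ?_
  have := one_sub_norm_le_norm_torusCoe_sub (f z) ζ (g z)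
  have := h z
  exact pow_ne_zero 2 (by linarith)

/-- All coordinates of `bζ - λζ` have the same modulus `|b - λ|`, so the maximum norm equals it. -/
lemma sliceKernel_rotate [NeZero n] (lam : ℂ) (ζ : Torus n) (b : Circle) :
    sliceKernel lam ζ (rotate b ζ) = diskKernel lam b := by
  have : ‖torusCoe (rotate b ζ) - lam • torusCoe ζ‖ = ‖(b : ℂ) - lam‖ := by
    have e : torusCoe (rotate b ζ) - lam • torusCoe ζ = fun j => ((b : ℂ) - lam) * ζ j := by
      funext j
      simp [torusCoe, rotate, sub_mul]
    have e2 (j : Fin n) : ‖((b : ℂ) - lam) * ζ j‖ = ‖(b : ℂ) - lam‖ := by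
      rw [norm_mul, Circle.norm_coe, mul_one]
    rw [e]
    refine le_antisymm ((pi_norm_le_iff_of_nonneg (norm_nonneg _)).2 fun j => (e2 j).le) ?_
    rw [← e2 0]
    exact norm_le_pi_norm (fun j => ((b : ℂ) - lam) * ζ j) 0
  rw [sliceKernel, diskKernel, this]

lemma isClosed_circleThrough (ζ : Torus n) : IsClosed (circleThrough ζ) :=
  (isCompact_range (continuous_rotate_left ζ)).isClosed

/-- The slice measure is the image, under `η ↦ ηζ`, of the representing measure on the circle. -/
lemma exists_isSliceMeasure [NeZero n] {μ : ComplexMeasure (Torus n)}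
    (hμ : IsPluriharmonicMeasure μ) {ζ : Torus n} {C : ℝ}
    (hC : ∀ j, ∫ η : Circle, ‖poissonIntegral μ (((radius j : ℂ) * η) • torusCoe ζ)‖
      ∂circleMeasure ≤ C) : ∃ ν, IsSliceMeasure μ ζ ν := by
  obtain ⟨ρ, _, h⟩ := exists_poisson_representation (hμ.harmonic_slice ζ) hC
  have hm : Measurable fun η : Circle => rotate η ζ := (continuous_rotate_left ζ).measurable
  refine ⟨combination fun k => (ρ k).map fun η => rotate η ζ, ⟨fun E hE hd => ?_, fun lam hlam => ?_⟩⟩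
  · rw [combination_apply _ hE]
    refine Finset.sum_eq_zero fun k _ => ?_
    have : (fun η : Circle => rotate η ζ) ⁻¹' E = ∅ := by
      ext η
      simpa using fun hη : rotate η ζ ∈ E => Set.disjoint_left.1 hd hη ⟨η, rfl⟩
    rw [map_measureReal_apply hm hE, this]
    simp
  · have hc : Continuous fun w => ((sliceKernel lam ζ w : ℝ) : ℂ) :=
      continuous_ofReal.comp (continuous_sliceKernel ζ continuous_const continuous_id fun _ => hlam)
    refine (h lam hlam).trans ((cintegral_combination _
      fun k => integrable_of_continuous hc).trans ?_).symm
    refine Finset.sum_congr rfl fun k _ => ?_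
    rw [integral_map hm.aemeasurable hc.aestronglyMeasurable]
    simp_rw [sliceKernel_rotate]
    rw [integral_complex_ofReal]

lemma IsSliceMeasure.poissonIntegral_eq {μ ν : ComplexMeasure (Torus n)} {ζ : Torus n}
    (h : IsSliceMeasure μ ζ ν) {lam : ℂ} (hlam : ‖lam‖ < 1) :
    poissonIntegral μ (lam • torusCoe ζ) = cintegral ν fun w => (sliceKernel lam ζ w : ℂ) :=
  h.poisson_eq lam hlam

lemma sliceKernel_radius_rotate [NeZero n] (ζ : Torus n) (r : ℝ) (η b : Circle) :
    sliceKernel (r * η) ζ (rotate b ζ) = diskKernel (r * b) η :=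
  (sliceKernel_rotate (r * η) ζ b).trans (diskKernel_comm r η b)

lemma tendsto_integral_mul_diskKernel (g : C(Circle, ℂ)) (b : Circle) :
    Tendsto (fun j => ∫ η, g η * (diskKernel (radius j * b) η : ℂ) ∂circleMeasure) atTop
      (𝓝 (g b)) := by
  have hr (j : ℕ) : ‖(radius j : ℂ) * b‖ < 1 :=
    norm_real_mul_coe_lt (radius_pos j).le (radius_lt_one j) b
  refine tendsto_integral_approximate_identity g b
    (fun j => continuous_diskKernel_right (hr j)) (fun j η => diskKernel_nonneg (hr j) η)
    (fun j => integral_diskKernel (hr j)) ?_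
  have e (j : ℕ) := integral_dist_sq_diskKernel (radius_pos j).le (radius_lt_one j) b
  simp_rw [e]
  simpa using (tendsto_radius.const_mul 2).const_sub 2

/-- The slice measure is the weak limit of the dilates of the slice function. -/
lemma IsSliceMeasure.tendsto [NeZero n] {μ ν : ComplexMeasure (Torus n)} {ζ : Torus n}
    (h : IsSliceMeasure μ ζ ν) (f : C(Torus n, ℂ)) :
    Tendsto (fun j => ∫ η : Circle, f (rotate η ζ) *
      poissonIntegral μ (((radius j : ℂ) * η) • torusCoe ζ) ∂circleMeasure) atTop
      (𝓝 (cintegral ν f)) := by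
  obtain ⟨ρ, _, rfl, hρ⟩ := exists_eq_combination_supported ν
    (isClosed_circleThrough ζ).measurableSet h.supported
  -- On the support the slice kernel is a disc kernel, hence an approximate identity; elsewhere only
  -- its continuity is used.
  have hρ' (k : Fin 4) : ∀ᵐ w ∂ρ k, ∃ b, w = rotate b ζ := by
    filter_upwards [hρ k]
    rintro w ⟨b, rfl⟩
    exact ⟨b, rfl⟩
  have hr (j : ℕ) (η : Circle) : ‖(radius j : ℂ) * η‖ < 1 :=
    norm_real_mul_coe_lt (radius_pos j).le (radius_lt_one j) η
  have hc (j : ℕ) : Continuous fun p : Circle × Torus n => sliceKernel (radius j * p.1) ζ p.2 :=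
    continuous_sliceKernel ζ (by fun_prop) continuous_snd fun _ => hr j _
  have hc' (j : ℕ) (η : Circle) : Continuous fun w => sliceKernel (radius j * η) ζ w :=
    continuous_sliceKernel ζ continuous_const continuous_id fun _ => hr j _
  have e (j : ℕ) (η : Circle) : poissonIntegral (n := n) μ (((radius j : ℂ) * η) • torusCoe ζ) =
      ∑ k : Fin 4, I ^ (k : ℕ) * ∫ w, (sliceKernel (radius j * η) ζ w : ℂ) ∂ρ k := by
    rw [h.poissonIntegral_eq (hr j η)]
    exact cintegral_combination ρ fun k =>
      integrable_of_continuous (continuous_ofReal.comp (hc' j η))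
  simp_rw [e]
  rw [cintegral_combination ρ fun k => integrable_of_continuous f.continuous]
  let g : C(Circle, ℂ) := f.comp ⟨_, continuous_rotate_left ζ⟩
  refine tendsto_integral_mul_kernel_integral ρ
    (K := fun j (η : Circle) w => sliceKernel (radius j * η) ζ w) hc
    g (fun k => ?_) (fun k => ?_) (fun k => ?_)
  · filter_upwards [hρ' k]
    rintro w ⟨b, rfl⟩ j η
    rw [sliceKernel_rotate]
    exact diskKernel_nonneg (hr j η) b
  · filter_upwards [hρ' k]
    rintro w ⟨b, rfl⟩ j
    simp_rw [sliceKernel_radius_rotate]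
    exact integral_diskKernel (hr j b)
  · filter_upwards [hρ' k]
    rintro w ⟨b, rfl⟩
    simp_rw [sliceKernel_radius_rotate]
    exact tendsto_integral_mul_diskKernel g b

/-- The sequence in `IsSliceMeasure.tendsto` depends on `μ` and `ζ` only. -/
lemma IsSliceMeasure.unique [NeZero n] {μ ν ν' : ComplexMeasure (Torus n)} {ζ : Torus n}
    (h : IsSliceMeasure μ ζ ν) (h' : IsSliceMeasure μ ζ ν') : ν = ν' :=
  ext_of_cintegral_eq fun f => tendsto_nhds_unique (h.tendsto f) (h'.tendsto f)

/-- The integral means over the circles `r 𝕋ζ` are dominated by an integrable function of `ζ`. -/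
lemma exists_integrable_bound {μ : ComplexMeasure (Torus n)}
    (hμ : IsPluriharmonicMeasure μ) :
    ∃ G : Torus n → ℝ, Integrable G (torusMeasure n) ∧ ∀ᵐ ζ ∂torusMeasure n, ∀ j,
      ∫ η : Circle, ‖poissonIntegral μ (((radius j : ℂ) * η) • torusCoe ζ)‖ ∂circleMeasure ≤
        G ζ := by
  obtain ⟨ρ, _, rfl⟩ := exists_eq_combination μ
  set u := poissonIntegral (combination ρ)
  let M (j : ℕ) (ζ : Torus n) : ℝ :=
    ∫ η : Circle, ‖u (((radius j : ℂ) * η) • torusCoe ζ)‖ ∂circleMeasure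
  let L (j : ℕ) (ζ : Torus n) : ENNReal := ENNReal.ofReal (M j ζ)
  have hM0 (j : ℕ) (ζ : Torus n) : 0 ≤ M j ζ := integral_nonneg fun _ => norm_nonneg _
  have hu (j : ℕ) : Continuous fun ζ : Torus n => ‖u ((radius j : ℂ) • torusCoe ζ)‖ :=
    (continuous_comp_smul_torusCoe hμ.1.continuousOn (radius_pos j).le (radius_lt_one j)).norm
  have hu2 (j : ℕ) : Continuous fun p : Torus n × Circle =>
      ‖u (((radius j : ℂ) * p.2) • torusCoe p.1)‖ := by
    simp_rw [← smul_torusCoe_rotate]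
    exact (hu j).comp (continuous_rotate.comp (continuous_snd.prodMk continuous_fst))
  have hMm (j : ℕ) : StronglyMeasurable (M j) :=
    (hu2 j).stronglyMeasurable.integral_prod_right'
  have hMi (j : ℕ) : Integrable (M j) (torusMeasure n) :=
    Integrable.integral_prod_left (ν := circleMeasure) (integrable_of_continuous (hu2 j))
  have hMint (j : ℕ) : ∫ ζ, M j ζ ∂torusMeasure n ≤ ∑ k, (ρ k).real Set.univ := by
    have e := integral_integral_rotate (hu j)
    simp_rw [smul_torusCoe_rotate] at e
    exact e.trans_le (integral_norm_poissonIntegral_le ρ hμ.1.continuousOn (radius_pos j).le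
      (radius_lt_one j))
  have hLm (j : ℕ) : Measurable (L j) := (hMm j).measurable.ennreal_ofReal
  have hLmono : Monotone L := fun i j hij ζ => ENNReal.ofReal_le_ofReal
    (integral_norm_circle_mono (hμ.harmonic_slice ζ) (radius_pos i).le (radius_mono hij)
      (radius_lt_one j))
  -- Monotone convergence: the means increase with `j`, and their integrals share one bound.
  have hfin : ∫⁻ ζ, ⨆ j, L j ζ ∂torusMeasure n ≠ ⊤ := by
    rw [lintegral_iSup hLm hLmono]
    refine ne_top_of_le_ne_top (b := ENNReal.ofReal (∑ k, (ρ k).real Set.univ))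
      ENNReal.ofReal_ne_top (iSup_le fun j => ?_)
    rw [← ofReal_integral_eq_lintegral_ofReal (hMi j) (Eventually.of_forall (hM0 j))]
    exact ENNReal.ofReal_le_ofReal (hMint j)
  have hm : Measurable fun ζ => ⨆ j, L j ζ := Measurable.iSup hLm
  refine ⟨fun ζ => (⨆ j, L j ζ).toReal,
    integrable_toReal_of_lintegral_ne_top hm.aemeasurable hfin, ?_⟩
  filter_upwards [ae_lt_top hm hfin] with ζ hζ j
  have h1 := ENNReal.toReal_mono hζ.ne (le_iSup (fun j => L j ζ) j)
  rwa [ENNReal.toReal_ofReal (hM0 j ζ)] at h1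

/-- The slice measures of a pluriharmonic measure integrate to the measure. -/
lemma integral_slices [NeZero n] {μ : ComplexMeasure (Torus n)} (hμ : IsPluriharmonicMeasure μ)
    {G : Torus n → ℝ} (hG : Integrable G (torusMeasure n))
    (hbound : ∀ᵐ ζ ∂torusMeasure n, ∀ j,
      ∫ η : Circle, ‖poissonIntegral μ (((radius j : ℂ) * η) • torusCoe ζ)‖ ∂circleMeasure ≤ G ζ)
    {σ : Torus n → ComplexMeasure (Torus n)}
    (hσ : ∀ᵐ ζ ∂torusMeasure n, IsSliceMeasure μ ζ (σ ζ)) (f : C(Torus n, ℂ)) :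
    Integrable (fun ζ => cintegral (σ ζ) f) (torusMeasure n) ∧
      cintegral μ f = ∫ ζ, cintegral (σ ζ) f ∂torusMeasure n := by
  set u := poissonIntegral μ
  let Φ (j : ℕ) (ζ : Torus n) : ℂ :=
    ∫ η : Circle, f (rotate η ζ) * u (((radius j : ℂ) * η) • torusCoe ζ) ∂circleMeasure
  have hF (j : ℕ) : Continuous fun ζ : Torus n => f ζ * u ((radius j : ℂ) • torusCoe ζ) :=
    f.continuous.mul
      (continuous_comp_smul_torusCoe hμ.1.continuousOn (radius_pos j).le (radius_lt_one j))
  have hΦm (j : ℕ) : AEStronglyMeasurable (Φ j) (torusMeasure n) := by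
    have h : Continuous fun p : Torus n × Circle =>
        f (rotate p.2 p.1) * u (((radius j : ℂ) * p.2) • torusCoe p.1) := by
      simp_rw [← smul_torusCoe_rotate]
      exact (hF j).comp (continuous_rotate.comp (continuous_snd.prodMk continuous_fst))
    exact (h.stronglyMeasurable.integral_prod_right' (ν := circleMeasure)).aestronglyMeasurable
  have hΦint (j : ℕ) : ∫ ζ, Φ j ζ ∂torusMeasure n =
      ∫ ζ, f ζ * u ((radius j : ℂ) • torusCoe ζ) ∂torusMeasure n := by
    have e := integral_integral_rotate (hF j)
    simp_rw [smul_torusCoe_rotate] at e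
    exact e
  have hΦbound (j : ℕ) : ∀ᵐ ζ ∂torusMeasure n, ‖Φ j ζ‖ ≤ ‖f‖ * G ζ := by
    filter_upwards [hbound] with ζ hζ
    have hc : Continuous fun η : Circle => u (((radius j : ℂ) * η) • torusCoe ζ) :=
      continuous_comp_real_mul_circle (hμ.harmonic_slice ζ).continuousOn (radius_pos j).le
        (radius_lt_one j)
    calc ‖Φ j ζ‖
        ≤ ∫ η : Circle, ‖f‖ * ‖u (((radius j : ℂ) * η) • torusCoe ζ)‖ ∂circleMeasure := by
          refine norm_integral_le_of_norm_le ((integrable_of_continuous hc.norm).const_mul _)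
            (Eventually.of_forall fun η => ?_)
          rw [norm_mul]
          exact mul_le_mul_of_nonneg_right (f.norm_coe_le_norm _) (norm_nonneg _)
      _ ≤ ‖f‖ * G ζ := by
          rw [integral_const_mul]
          exact mul_le_mul_of_nonneg_left (hζ j) (norm_nonneg _)
  have hlim : ∀ᵐ ζ ∂torusMeasure n, Tendsto (fun j => Φ j ζ) atTop (𝓝 (cintegral (σ ζ) f)) := by
    filter_upwards [hσ] with ζ hζ
    exact hζ.tendsto f
  -- Measurability in `ζ` comes from the limit, as `σ` itself is an arbitrary selection.
  refine ⟨(hG.const_mul ‖f‖).mono' (aestronglyMeasurable_of_tendsto_ae atTop hΦm hlim) ?_, ?_⟩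
  · filter_upwards [hlim, ae_all_iff.2 hΦbound] with ζ h1 h2
    exact le_of_tendsto h1.norm (Eventually.of_forall h2)
  · have h1 := tendsto_integral_of_dominated_convergence _ hΦm (hG.const_mul ‖f‖) hΦbound hlim
    simp_rw [hΦint] at h1
    obtain ⟨ρ, _, rfl⟩ := exists_eq_combination μ
    -- The same integrals over the torus have both sides of the formula as limits.
    exact tendsto_nhds_unique (tendsto_integral_mul_poissonIntegral ρ f) h1

end Slices

end TorusSlices

end

theorem proposition2p3 (n : ℕ) (hn : 2 ≤ n)
    (μ : ComplexMeasure (TorusSlices.Torus n)) (hμ : TorusSlices.IsPluriharmonicMeasure μ) :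
    (∀ᵐ ζ ∂(TorusSlices.torusMeasure n),
      ∃! ν : ComplexMeasure (TorusSlices.Torus n), TorusSlices.IsSliceMeasure μ ζ ν) ∧
    ∀ σ : TorusSlices.Torus n → ComplexMeasure (TorusSlices.Torus n),
      (∀ᵐ ζ ∂(TorusSlices.torusMeasure n), TorusSlices.IsSliceMeasure μ ζ (σ ζ)) →
      ∀ f : C(TorusSlices.Torus n, ℂ),
        Integrable (fun ζ => TorusSlices.cintegral (σ ζ) f) (TorusSlices.torusMeasure n) ∧
        TorusSlices.cintegral μ f =
          ∫ ζ, TorusSlices.cintegral (σ ζ) f ∂(TorusSlices.torusMeasure n) := by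
  -- The maximum norm needs a coordinate to see the distance to the circle.
  have : NeZero n := ⟨by omega⟩
  obtain ⟨G, hG, hbound⟩ := TorusSlices.exists_integrable_bound hμ
  refine ⟨?_, fun σ hσ f => ?_⟩
  · filter_upwards [hbound] with ζ hζ
    obtain ⟨ν, hν⟩ := TorusSlices.exists_isSliceMeasure hμ hζ
    exact ⟨ν, hν, fun ν' hν' => hν'.unique hν⟩
  · exact TorusSlices.integral_slices hμ hG hbound hσ f
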